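/- **Setting.** An *extensional Kan complex* $\langle K,F,G,\varepsilon,\eta\rangle$ is a Kan complex $K$ with simplicial maps $F:K\to[K\to K]$, $G:[K\to K]\to K$, where $[K\to K]=\mathrm{Fun}(K,K)$, and natural equivalences (homotopies) $\varepsilon: FG\to 1_{[K\to K]}$ and $\eta:1_K\to GF$. Put $f\bullet g=F(f)(g)$. Untyped $\lambda$-terms are interpreted under valuations $\rho$ of the variables in $K$ by $[\![x]\!]_\rho=\rho(x)$, $[\![MN]\!]_\rho=[\![M]\!]_\rho\bullet[\![N]\!]_\rho$, $[\![\lambda x.M]\!]_\rho=G(f\mapsto[\![M]\!]_{[f/x]\rho})$; in particular, for $\rho$ with values in the vertices of $K$ there is a map $[\![P]\!]_{[- /x]\rho}:K\to K$. For a simplicial set $X$ with vertices $a,b$ let $X(a,b)$ be the fibre of $\mathrm{Fun}(\Delta^1,X)\to X\times X$ over $(a,b)$. An *$n$-cell* of $X$ is a vertex of an iterated mapping space $X(a_0,b_0)(a_1,b_1)\cdots(a_{n-1},b_{n-1})$, where $a_i,b_i$ are vertices of $X(a_0,b_0)\cdots(a_{i-1},b_{i-1})$; for $n\ge1$ it goes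 from the $(n-1)$-cell $a_{n-1}$ to the $(n-1)$-cell $b_{n-1}$. Simplicial maps act on cells. Let $\Lambda_0$ be the set of $\lambda$-terms. For $n\ge 1$, an $n$-conversion $t\in\Lambda_n$ consists of two $\lambda$-terms $M,N$ and, for every extensional Kan complex and every valuation $\rho$ in its vertices, an $n$-cell $[\![t]\!]_\rho$ of $K$ with $a_0=[\![M]\!]_\rho$ and $b_0=[\![N]\!]_\rho$. Its source $r$ and target $s$ are elements of $\Lambda_{n-1}$, and one writes $t\in\Lambda_n(r,s)$. The variable $y$ is not free in $t$ if $y\notin FV(M)\cup FV(N)$ and $[\![t]\!]_\rho$ does not depend on $\rho(y)$. For $t\in\Lambda_n$ with $n\geq1$ put $[\![(\lambda x.P)t]\!]_\rho=[\![\lambda x.P]\!]_\rho\bullet[\![t]\!]_\rho$, $[\![[t/x]P]\!]_\rho=[\![P]\!]_{[- /x]\rho}([\![t]\!]_\rho)$ and, if $y$ is not free in $t$, $[\![\lambda y.ty]\!]_\rho=G(F([\![t]\!]_\rho))$; for $t\in\Lambda_0$ these are the interpretations of the $\lambda$-terms $(\lambda x.P)t$, $[t/x]P$ (capture-avoiding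 substitution) and $\lambda y.ty$. The components $a\mapsto\big((\varepsilon_g)_a:FG(g)(a)\to g(a)\big)$ of $\varepsilon$ at $g=[\![P]\!]_{[- /x]\rho}$ form a map $K\to\mathrm{Fun}(\Delta^1,K)$. For $t\in\Lambda_n$, $n\ge0$, the interpretation of the $(n+1)\beta$-contraction $(n+1)\beta_t:(\lambda x.P)t\to[t/x]P$ is the image of $[\![t]\!]_\rho$ under this map, an $n$-cell of $\mathrm{Fun}(\Delta^1,K)$. The interpretation of the $(n+1)\eta$-contraction $(n+1)\eta_t:\lambda y.ty\to t$ is, likewise, the image of $[\![t]\!]_\rho$ under the components of an inverse $\tilde\eta:GF\to1_K$ of $\eta$ (up to homotopy). **Corollary 2.1.** Let $n\ge1$, $r,s\in\Lambda_{n-1}$, $t\in\Lambda_n(r,s)$, let $x,y$ be variables and $P$ a $\lambda$-term, with $y$ not free in $t$ for the second square. In every extensional Kan complex, for every valuation $\rho$ in its vertices, an inverse $\tilde\eta$ of $\eta$ exists, and, for every such $\tilde\eta$, the interpretations of the squares $$\begin{array}{ccc}(\lambda x.P)r&\xrightarrow{\;n\beta_r\;}&[r/x]P\\ {\scriptstyle(\lambda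 x.P)t}\downarrow&&\downarrow{\scriptstyle[t/x]P}\\ (\lambda x.P)s&\xrightarrow{\;n\beta_s\;}&[s/x]P\end{array}\qquad\qquad\begin{array}{ccc}\lambda y.ry&\xrightarrow{\;n\eta_r\;}&r\\ {\scriptstyle\lambda y.ty}\downarrow&&\downarrow{\scriptstyle t}\\ \lambda y.sy&\xrightarrow{\;n\eta_s\;}&s\end{array}$$ commute: the sides have the indicated ends, and there is an $n$-cell of $\mathrm{Fun}(\Delta^1,K)$ from the upper to the lower horizontal side whose images under the evaluations at $0$ and $1$ are the left and the right vertical side (for $n=1$: a map $\Delta^1\times\Delta^1\to K$ with the four given sides). Such $n$-cells are given by the interpretations of the $(n+1)\beta$-contraction $(n+1)\beta_t$ and of the $(n+1)\eta$-contraction $(n+1)\eta_t$, respectively. -/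

import Mathlib

open CategoryTheory MonoidalCategory CartesianMonoidalCategory

universe u

noncomputable section

namespace HigherLambda

/-! ### The untyped λ-calculus -/

/-- The (countably infinite) set of variables. -/
abbrev Var : Type := ℕ

/-- Untyped λ-terms with named variables. -/
inductive Term : Type
  | var (x : Var) : Term
  | app (M N : Term) : Term
  | lam (x : Var) (M : Term) : Term

namespace Term

/-- The free variables of a term. -/
def FV : Term → Finset Var
  | var x => {x}
  | app M N => M.FV ∪ N.FV
  | lam x M => M.FV.erase x

/-- Simultaneous capture-avoiding substitution: a bound variable is renamed exactly when it would
capture a free variable of one of the substituted terms. -/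
def substAll : Term → (Var → Term) → Term
  | var x, σ => σ x
  | app M N, σ => app (M.substAll σ) (N.substAll σ)
  | lam x M, σ =>
      let S : Finset Var := (M.FV.erase x).biUnion fun v => (σ v).FV
      let z : Var := if x ∈ S then S.sup id + 1 else x
      lam z (M.substAll (Function.update σ x (var z)))

/-- `[N/x]P`. -/
def subst (N : Term) (x : Var) (P : Term) : Term :=
  P.substAll (Function.update var x N)

end Term

/-! ### Arrow complexes, mapping spaces and their iteration -/

section

open Simplicial

/-- The vertices of a simplicial set. -/
abbrev Vertex (X : SSet.{u}) : Type u := X _⦋0⦌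

/-- The function complex `[X → Y] = Fun(X, Y)`. -/
abbrev Fun (X Y : SSet.{u}) : SSet.{u} := (ihom X).obj Y

/-- The arrow complex `Fun(Δ¹, X)`. -/
abbrev Arr (X : SSet.{u}) : SSet.{u} := Fun (Δ[1] : SSet.{u}) X

/-- Evaluation `Fun(Δ¹, X) ⟶ X` at the vertex `i` of `Δ¹`. -/
def evAt (X : SSet.{u}) (i : Fin 2) : Arr X ⟶ X :=
  lift (SSet.const (SSet.stdSimplex.obj₀Equiv.symm i)) (𝟙 (Arr X)) ≫
    (ihom.ev (Δ[1] : SSet.{u})).app X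

theorem map_comp_evAt {X Y : SSet.{u}} (f : X ⟶ Y) (i : Fin 2) :
    (ihom (Δ[1] : SSet.{u})).map f ≫ evAt Y i = evAt X i ≫ f := by
  rfl

theorem app_mem_ofSimplex {X Y : SSet.{u}} (f : X ⟶ Y) (a : Vertex X) {m : SimplexCategoryᵒᵖ}
    (y : X.obj m) (hy : y ∈ (SSet.Subcomplex.ofSimplex a).obj m) :
    f.app m y ∈ (SSet.Subcomplex.ofSimplex (f.app _ a)).obj m := by
  rw [SSet.Subcomplex.mem_ofSimplex_obj_iff] at hy ⊢
  obtain ⟨g, rfl⟩ := hy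
  exact ⟨g, (NatTrans.naturality_apply f g.op a).symm⟩

/-- The mapping space `X(a,b)`: the fibre of `Fun(Δ¹, X) ⟶ X × X` over `(a,b)`. -/
def mapSpace {X : SSet.{u}} (a b : Vertex X) : (Arr X).Subcomplex :=
  (SSet.Subcomplex.ofSimplex a).preimage (evAt X 0) ⊓
    (SSet.Subcomplex.ofSimplex b).preimage (evAt X 1)

/-- The map `X(a,b) ⟶ Y(f a, f b)` induced by `f : X ⟶ Y`. -/
def mapSpaceMap {X Y : SSet.{u}} (f : X ⟶ Y) (a b : Vertex X) :
    (mapSpace a b : SSet.{u}) ⟶ (mapSpace (f.app _ a) (f.app _ b) : SSet.{u}) :=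
  SSet.Subcomplex.lift ((mapSpace a b).ι ≫ (ihom (Δ[1] : SSet.{u})).map f) (by
    rintro m _ ⟨⟨c, hc⟩, rfl⟩
    exact ⟨app_mem_ofSimplex f a _ hc.1, app_mem_ofSimplex f b _ hc.2⟩)

end

/-- The `n`-cells of `X`: the vertices of the iterated mapping spaces
`X(a₀,b₀)(a₁,b₁)⋯(aₙ₋₁,bₙ₋₁)`, recorded together with all the `aᵢ` and `bᵢ`. -/
def Cell : ℕ → SSet.{u} → Type u
  | 0, X => Vertex X
  | n + 1, X => Σ a b : Vertex X, Cell n (mapSpace a b : SSet.{u})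

namespace Cell

/-- The action of a simplicial map on cells. -/
def map : ∀ {n : ℕ} {X Y : SSet.{u}}, (X ⟶ Y) → Cell n X → Cell n Y
  | 0, _, _, f, a => f.app _ a
  | _ + 1, _, _, f, ⟨a, b, c⟩ => ⟨f.app _ a, f.app _ b, map (mapSpaceMap f a b) c⟩

/-- The source of an `(n+1)`-cell: the last of the `aᵢ`. -/
def src : ∀ {n : ℕ} {X : SSet.{u}}, Cell (n + 1) X → Cell n X
  | 0, _, ⟨a, _, _⟩ => a
  | _ + 1, _, ⟨a, b, c⟩ => ⟨a, b, src c⟩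

/-- The target of an `(n+1)`-cell: the last of the `bᵢ`. -/
def tgt : ∀ {n : ℕ} {X : SSet.{u}}, Cell (n + 1) X → Cell n X
  | 0, _, ⟨_, b, _⟩ => b
  | _ + 1, _, ⟨a, b, c⟩ => ⟨a, b, tgt c⟩

/-- The domain of an `n`-cell of arrows of `X`. -/
def dom {n : ℕ} {X : SSet.{u}} (c : Cell n (Arr X)) : Cell n X := c.map (evAt X 0)

/-- The codomain of an `n`-cell of arrows of `X`. -/
def cod {n : ℕ} {X : SSet.{u}} (c : Cell n (Arr X)) : Cell n X := c.map (evAt X 1)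

end Cell

/-- The square with corners `a`, `b`, `c`, `d`, horizontal sides `top : a → b`, `bot : c → d` and
vertical sides `left : a → c`, `right : b → d` commutes by means of `σ`. The corners are `n`-cells
of `X`, the vertical sides are `(n+1)`-cells of `X`, and the horizontal sides are `n`-cells of
arrows of `X`, as they need not fix the lower-dimensional boundary of the corners. For `n = 0`,
`σ` is an edge of `Fun(Δ¹, X)`, that is, a map `Δ¹ × Δ¹ ⟶ X` with the four given sides. For
`n > 0`, `σ` lies in an iterated mapping space of `Fun(Δ¹, X)`, so that the square is filled
relative to the lower-dimensional boundaries of its sides. -/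
structure CommutesVia {n : ℕ} {X : SSet.{u}} (σ : Cell (n + 1) (Arr X)) (a b c d : Cell n X)
    (top bot : Cell n (Arr X)) (left right : Cell (n + 1) X) : Prop where
  top_dom : top.dom = a
  top_cod : top.cod = b
  bot_dom : bot.dom = c
  bot_cod : bot.cod = d
  left_src : left.src = a
  left_tgt : left.tgt = c
  right_src : right.src = b
  right_tgt : right.tgt = d
  src_eq : σ.src = top
  tgt_eq : σ.tgt = bot
  dom_eq : σ.dom = left
  cod_eq : σ.cod = right

/-! ### Reflexive and extensional Kan complexes -/

section

open Simplicial

/-- A reflexive Kan complex. As the target of `ε` is a Kan complex, a natural equivalence is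
the same thing as a homotopy. -/
structure ReflexiveKan where
  K : SSet.{u}
  kan : SSet.KanComplex K
  F : K ⟶ Fun K K
  G : Fun K K ⟶ K
  ε : SSet.Homotopy (G ≫ F) (𝟙 (Fun K K))

/-- An extensional Kan complex. -/
structure ExtensionalKan extends ReflexiveKan.{u} where
  η : SSet.Homotopy (𝟙 K) (F ≫ G)

/-- The map `X ⟶ Fun(Δ¹, Y)`, `a ↦ (f a → g a)`, given by the components of a homotopy. -/
def component {X Y : SSet.{u}} {f g : X ⟶ Y} (H : SSet.Homotopy f g) : X ⟶ Arr Y :=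
  MonoidalClosed.curry (lift (snd _ _) (fst _ _) ≫ H.h)

/-- `H'` is inverse to `H` up to homotopy: in `Fun(X, Y)` there are 2-simplices exhibiting the
identities as composites of `H` and `H'`, in both orders. -/
def AreInverse {X Y : SSet.{u}} {f g : X ⟶ Y} (H : SSet.Homotopy f g) (H' : SSet.Homotopy g f) :
    Prop :=
  (∃ T : X ⊗ (Δ[2] : SSet.{u}) ⟶ Y,
      X ◁ SSet.stdSimplex.δ 2 ≫ T = H.h ∧ X ◁ SSet.stdSimplex.δ 0 ≫ T = H'.h ∧
        X ◁ SSet.stdSimplex.δ 1 ≫ T = fst _ _ ≫ f) ∧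
  (∃ T : X ⊗ (Δ[2] : SSet.{u}) ⟶ Y,
      X ◁ SSet.stdSimplex.δ 2 ≫ T = H'.h ∧ X ◁ SSet.stdSimplex.δ 0 ≫ T = H.h ∧
        X ◁ SSet.stdSimplex.δ 1 ≫ T = fst _ _ ≫ g)

end

namespace ReflexiveKan

variable (R : ReflexiveKan.{u})

/-- Application `f • g = F(f)(g)`, for `f` and `g` depending on a parameter in `X`. -/
def app {X : SSet.{u}} (f g : X ⟶ R.K) : X ⟶ R.K :=
  lift g (f ≫ R.F) ≫ (ihom.ev R.K).app R.K

/-- The valuation `[f/x]ρ`. -/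
def updateVal {X : SSet.{u}} (ρ : Var → (X ⟶ R.K)) (x : Var) (f : X ⟶ R.K) : Var → (X ⟶ R.K) :=
  Function.update ρ x f

/-- The interpretation of a term under a valuation of the variables by elements of `K` with
parameters in `X`; for `X = Δⁿ` these are the `n`-simplices of `K`. The map
`f ↦ ⟦M⟧_{[f/x]ρ}` is the transpose `X ⟶ [K → K]` of the interpretation of `M` with parameters
in `K × X`. -/
def interp : Term → ∀ {X : SSet.{u}}, (Var → (X ⟶ R.K)) → (X ⟶ R.K)
  | .var x, _, ρ => ρ x
  | .app M N, _, ρ => R.app (interp M ρ) (interp N ρ)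
  | .lam x M, X, ρ =>
      MonoidalClosed.curry
        (interp M (R.updateVal (fun v => snd R.K X ≫ ρ v) x (fst R.K X))) ≫ R.G

end ReflexiveKan

section

open Simplicial

namespace ReflexiveKan

variable (R : ReflexiveKan.{u})

/-- `⟦M⟧_ρ`, an `n`-simplex of `K`, for a valuation `ρ` in the `n`-simplices of `K`. -/
def interpSimplex {n : ℕ} (M : Term) (ρ : Var → R.K _⦋n⦌) : R.K _⦋n⦌ :=
  SSet.yonedaEquiv (R.interp M fun v => SSet.yonedaEquiv.symm (ρ v))

/-- Valuations in the vertices of `K`. -/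
abbrev Valuation : Type u := Var → Vertex R.K

/-- The functor `⟦P⟧_{[·/x]ρ} : K ⟶ K`. -/
def interpFun (x : Var) (P : Term) (ρ : R.Valuation) : R.K ⟶ R.K :=
  R.interp P (R.updateVal (fun v => SSet.const (ρ v)) x (𝟙 R.K))

/-- The functor `F(a) = a • (-) : K ⟶ K`. -/
def appLeft (a : Vertex R.K) : R.K ⟶ R.K :=
  R.app (SSet.const a) (𝟙 R.K)

/-- The components `(ε_g)_a : F(G(g))(a) → g(a)` of `ε` at `g : K ⟶ K`, as a map in `a`. -/
def epsilonAt (g : R.K ⟶ R.K) : R.K ⟶ Arr R.K :=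
  MonoidalClosed.curry
    (lift (snd _ _)
      (lift (MonoidalClosed.curry (fst R.K ((Δ[1] : SSet.{u}) ⊗ R.K) ≫ g)) (fst _ _) ≫ R.ε.h) ≫
      (ihom.ev R.K).app R.K)

end ReflexiveKan

end

/-! ### Higher conversions -/

/-- The families `Λ_n`: `Λ_0` consists of the λ-terms, and an element of `Λ_{n+1}` is an
`(n+1)`-conversion, i.e. two λ-terms `M`, `N` together with, in every extensional Kan complex and
for every valuation `ρ`, a vertex of an `n`-fold iterated mapping space of `K(⟦M⟧_ρ, ⟦N⟧_ρ)`. -/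
inductive Conv : ℕ → Type (u + 1)
  | term (M : Term) : Conv 0
  | conv {n : ℕ} (M N : Term)
      (c : ∀ (E : ExtensionalKan.{u}) (ρ : E.Valuation),
        Cell n (mapSpace (E.interpSimplex M ρ) (E.interpSimplex N ρ) : SSet.{u})) : Conv (n + 1)

namespace Conv

/-- The source of an `(n+1)`-conversion. -/
def src : ∀ {n : ℕ}, Conv.{u} (n + 1) → Conv.{u} n
  | 0, conv M _ _ => term M
  | _ + 1, conv M N c => conv M N fun E ρ => (c E ρ).src

/-- The target of an `(n+1)`-conversion. -/
def tgt : ∀ {n : ℕ}, Conv.{u} (n + 1) → Conv.{u} n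
  | 0, conv _ N _ => term N
  | _ + 1, conv M N c => conv M N fun E ρ => (c E ρ).tgt

/-- `t` is a conversion from `r` to `s`. -/
def Between {n : ℕ} (t : Conv.{u} (n + 1)) (r s : Conv.{u} n) : Prop :=
  t.src = r ∧ t.tgt = s

variable (E : ExtensionalKan.{u}) (ρ : E.Valuation)

/-- The interpretation `⟦t⟧_ρ`. -/
def interp : ∀ {n : ℕ}, Conv.{u} n → Cell n E.K
  | _, term M => E.interpSimplex M ρ
  | _, conv M N c => ⟨E.interpSimplex M ρ, E.interpSimplex N ρ, c E ρ⟩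

/-- `y ∉ FV(t)`: the variable `y` is not free in the underlying λ-terms, and the interpretation of
`t` does not depend on the value of `y`. -/
def NotFree (y : Var) : ∀ {n : ℕ}, Conv.{u} n → Prop
  | _, term M => y ∉ M.FV
  | _, conv M N c => y ∉ M.FV ∧ y ∉ N.FV ∧
      ∀ (E : ExtensionalKan.{u}) (ρ : E.Valuation) (a : Vertex E.K),
        (conv M N c).interp E (Function.update ρ y a) = (conv M N c).interp E ρ

/-- The interpretation of `(λx.P)t`. For a higher conversion `t` it is `⟦λx.P⟧_ρ • ⟦t⟧_ρ`. -/
def betaRedex (x : Var) (P : Term) : ∀ {n : ℕ}, Conv.{u} n → Cell n E.K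
  | _, term M => E.interpSimplex (.app (.lam x P) M) ρ
  | _, conv M N c =>
      ((conv M N c).interp E ρ).map (E.appLeft (E.interpSimplex (.lam x P) ρ))

/-- The interpretation of `[t/x]P`. For a higher conversion `t` it is `⟦P⟧_{[⟦t⟧_ρ/x]ρ}`. -/
def betaContractum (x : Var) (P : Term) : ∀ {n : ℕ}, Conv.{u} n → Cell n E.K
  | _, term M => E.interpSimplex (Term.subst M x P) ρ
  | _, conv M N c => ((conv M N c).interp E ρ).map (E.interpFun x P ρ)

/-- The interpretation of `λy.ty`, for `y ∉ FV(t)`. For a higher conversion `t` it is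
`G(f ↦ ⟦t⟧_ρ • f)`, and `f ↦ ⟦t⟧_ρ • f` is `F(⟦t⟧_ρ)`. -/
def etaRedex (y : Var) : ∀ {n : ℕ}, Conv.{u} n → Cell n E.K
  | _, term M => E.interpSimplex (.lam y (.app M (.var y))) ρ
  | _, conv M N c => ((conv M N c).interp E ρ).map (E.F ≫ E.G)

/-- The interpretation of the `(n+1)β`-contraction `(λx.P)t → [t/x]P` at `t ∈ Λ_n`: the component
at `⟦t⟧_ρ` of the natural equivalence induced by `ε` at `⟦P⟧_{[·/x]ρ}`. -/
def beta (x : Var) (P : Term) {n : ℕ} (t : Conv.{u} n) : Cell n (Arr E.K) :=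
  (t.interp E ρ).map (E.epsilonAt (E.interpFun x P ρ))

/-- The interpretation of the `(n+1)η`-contraction `λy.ty → t` at `t ∈ Λ_n`: the component at
`⟦t⟧_ρ` of an inverse `θ` of the natural equivalence `η`. -/
def eta (θ : SSet.Homotopy (E.F ≫ E.G) (𝟙 E.K)) {n : ℕ} (t : Conv.{u} n) : Cell n (Arr E.K) :=
  (t.interp E ρ).map (component θ)

end Conv

end HigherLambda

end

open HigherLambda

/-!
A map `h : X ⟶ Fun(Δ¹, Y)` with ends `f, g : X ⟶ Y` acts on an `(n+1)`-cell `t` of `X` to give a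
filler of the square with horizontal sides `h(src t)`, `h(tgt t)` and vertical sides `f(t)`, `g(t)`,
since taking sources and targets of cells is natural. For the components of `ε` at `⟦P⟧_{[·/x]ρ}`,
and for those of an inverse of `η`, the substitution lemma and the coincidence lemma for the
interpretation of λ-terms identify `f` and `g` with the maps defining the two sides of the
contraction. An inverse of `η` exists because homotopies are edges of a function complex, which is
a Kan complex, and every edge of a Kan complex is invertible.
-/

noncomputable section

namespace HigherLambda

/-! ### Functoriality of cells -/

namespace Cell

/-- An `n`-cell of the mapping space `X(a,b)`, regarded as an `(n+1)`-cell of `X`; used to apply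
congruence under the first two entries of a cell. -/
def cons {n : ℕ} {X : SSet.{u}} (a b : Vertex X) (c : Cell n (mapSpace a b : SSet.{u})) :
    Cell (n + 1) X :=
  ⟨a, b, c⟩

theorem map_id : ∀ {n : ℕ} {X : SSet.{u}} (c : Cell n X), c.map (𝟙 X) = c
  | 0, _, _ => rfl
  | _ + 1, _, ⟨a, b, c⟩ => congrArg (cons a b) (map_id c)

theorem map_map : ∀ {n : ℕ} {X Y Z : SSet.{u}} (f : X ⟶ Y) (g : Y ⟶ Z) (c : Cell n X),
    (c.map f).map g = c.map (f ≫ g)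
  | 0, _, _, _, _, _, _ => rfl
  | _ + 1, _, _, _, f, g, ⟨a, b, c⟩ =>
    congrArg (cons _ _) (map_map (mapSpaceMap f a b) (mapSpaceMap g _ _) c)

theorem src_map : ∀ {n : ℕ} {X Y : SSet.{u}} (f : X ⟶ Y) (c : Cell (n + 1) X),
    (c.map f).src = c.src.map f
  | 0, _, _, _, ⟨_, _, _⟩ => rfl
  | _ + 1, _, _, f, ⟨a, b, c⟩ =>
    congrArg (cons _ _) (src_map (mapSpaceMap f a b) c)

theorem tgt_map : ∀ {n : ℕ} {X Y : SSet.{u}} (f : X ⟶ Y) (c : Cell (n + 1) X),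
    (c.map f).tgt = c.tgt.map f
  | 0, _, _, _, ⟨_, _, _⟩ => rfl
  | _ + 1, _, _, f, ⟨a, b, c⟩ =>
    congrArg (cons _ _) (tgt_map (mapSpaceMap f a b) c)

theorem commutesVia_map {n : ℕ} {X Y : SSet.{u}} {f g : X ⟶ Y} {h : X ⟶ Arr Y}
    (hf : h ≫ evAt Y 0 = f) (hg : h ≫ evAt Y 1 = g) (c : Cell (n + 1) X) :
    CommutesVia (c.map h) (c.src.map f) (c.src.map g) (c.tgt.map f) (c.tgt.map g)
      (c.src.map h) (c.tgt.map h) (c.map f) (c.map g) := by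
  subst hf hg
  constructor <;> simp only [dom, cod, map_map, src_map, tgt_map]

end Cell

/-! ### Evaluation in function complexes -/

section CartesianClosed

variable {C : Type*} [Category* C] [CartesianMonoidalCategory C] {A B X Y : C} [Closed A]

theorem lift_comp_curry_comp_ev (a : B ⟶ A) (b : B ⟶ X) (k : A ⊗ X ⟶ Y) :
    lift a (b ≫ MonoidalClosed.curry k) ≫ (ihom.ev A).app Y = lift a b ≫ k := by
  rw [← lift_whiskerLeft, Category.assoc, MonoidalClosed.whiskerLeft_curry_ihom_ev_app]

theorem curry_lift_fst_comp_ev (f : X ⟶ (ihom A).obj Y) :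
    MonoidalClosed.curry (lift (fst A X) (snd A X ≫ f) ≫ (ihom.ev A).app Y) = f := by
  rw [MonoidalClosed.curry_eq_iff, MonoidalClosed.uncurry_eq]
  congr 1
  ext <;> simp

theorem comp_curry_fst_comp (b : B ⟶ X) (g : A ⟶ Y) :
    b ≫ MonoidalClosed.curry (fst A X ≫ g) = MonoidalClosed.curry (fst A B ≫ g) := by
  rw [← MonoidalClosed.curry_natural_left, whiskerLeft_fst_assoc]

theorem lift_curry_fst_comp_ev (a : B ⟶ A) (g : A ⟶ Y) :
    lift a (MonoidalClosed.curry (fst A B ≫ g)) ≫ (ihom.ev A).app Y = a ≫ g := by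
  rw [← Category.id_comp (MonoidalClosed.curry _), lift_comp_curry_comp_ev, lift_fst_assoc]

end CartesianClosed

section Components

open Simplicial

theorem curry_comp_evAt {X Y : SSet.{u}} (k : Δ[1] ⊗ X ⟶ Y) (i : Fin 2) :
    MonoidalClosed.curry k ≫ evAt Y i =
      lift (SSet.const (SSet.stdSimplex.obj₀Equiv.symm i)) (𝟙 X) ≫ k := by
  rw [evAt, comp_lift_assoc, SSet.comp_const, Category.comp_id,
    ← Category.id_comp (MonoidalClosed.curry k), lift_comp_curry_comp_ev]

variable {X Y : SSet.{u}} {f g : X ⟶ Y} (H : SSet.Homotopy f g)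

theorem component_comp_evAt_zero : component H ≫ evAt Y 0 = f := by
  rw [component, curry_comp_evAt, comp_lift_assoc, lift_fst, lift_snd]
  exact H.h₀

theorem component_comp_evAt_one : component H ≫ evAt Y 1 = g := by
  rw [component, curry_comp_evAt, comp_lift_assoc, lift_fst, lift_snd]
  exact H.h₁

end Components

/-! ### Semantics of λ-terms -/

section

open Simplicial

theorem const_injective {X : SSet.{u}} :
    Function.Injective fun a : Vertex X => (SSet.const a : (Δ[0] : SSet.{u}) ⟶ X) := by
  intro a b h
  rw [← SSet.yonedaEquiv_const a, ← SSet.yonedaEquiv_const b]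
  exact congrArg SSet.yonedaEquiv h

end

theorem Term.renamed_notMem (S : Finset Var) (x : Var) :
    (if x ∈ S then S.sup id + 1 else x) ∉ S := by
  split_ifs with hx
  · exact fun h => Nat.not_succ_le_self _ (Finset.le_sup (f := id) h)
  · exact hx

namespace ReflexiveKan

variable (R : ReflexiveKan.{u})

theorem comp_app {X Y : SSet.{u}} (h : Y ⟶ X) (f g : X ⟶ R.K) :
    h ≫ R.app f g = R.app (h ≫ f) (h ≫ g) := by
  simp only [app, comp_lift_assoc, Category.assoc]

section Valuations

variable {X : SSet.{u}} (ρ : Var → (X ⟶ R.K)) (x : Var) (f : X ⟶ R.K)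

theorem updateVal_self : R.updateVal ρ x f x = f :=
  Function.update_self ..

theorem updateVal_of_ne {v : Var} (hv : v ≠ x) : R.updateVal ρ x f v = ρ v :=
  Function.update_of_ne hv ..

theorem comp_updateVal {Y : SSet.{u}} (h : Y ⟶ X) :
    (fun v => h ≫ R.updateVal ρ x f v) = R.updateVal (fun v => h ≫ ρ v) x (h ≫ f) :=
  funext fun v => Function.apply_update (fun _ k => h ≫ k) ρ x f v

theorem interp_update (σ : Var → Term) (N : Term) :
    (fun v => R.interp (Function.update σ x N v) ρ) =
      R.updateVal (fun v => R.interp (σ v) ρ) x (R.interp N ρ) :=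
  funext fun v => Function.apply_update (fun _ L => R.interp L ρ) σ x N v

variable {ρ} in
theorem updateVal_congr {ρ' : Var → (X ⟶ R.K)} {S : Finset Var}
    (h : ∀ v ∈ S.erase x, ρ v = ρ' v) : ∀ v ∈ S, R.updateVal ρ x f v = R.updateVal ρ' x f v := by
  intro v hv
  obtain rfl | hx := eq_or_ne v x
  · simp only [updateVal_self]
  · simp only [updateVal_of_ne _ _ _ _ hx, h v (Finset.mem_erase.2 ⟨hx, hv⟩)]

end Valuations

theorem interp_congr (M : Term) : ∀ {X : SSet.{u}} {ρ ρ' : Var → (X ⟶ R.K)},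
    (∀ v ∈ M.FV, ρ v = ρ' v) → R.interp M ρ = R.interp M ρ' := by
  induction M with
  | var x => exact fun h => h x (Finset.mem_singleton_self x)
  | app M N ihM ihN =>
    intro X ρ ρ' h
    rw [interp, interp, ihM fun v hv => h v (Finset.mem_union_left _ hv),
      ihN fun v hv => h v (Finset.mem_union_right _ hv)]
  | lam x M ih =>
    intro X ρ ρ' h
    rw [interp, interp, ih (R.updateVal_congr x _ fun v hv => by rw [h v hv])]

theorem interp_updateVal_of_notMem {X : SSet.{u}} {M : Term} {y : Var} (hy : y ∉ M.FV)
    (ρ : Var → (X ⟶ R.K)) (f : X ⟶ R.K) :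
    R.interp M (R.updateVal ρ y f) = R.interp M ρ :=
  R.interp_congr M fun _ hv => R.updateVal_of_ne _ _ _ (ne_of_mem_of_not_mem hv hy)

theorem comp_interp (M : Term) : ∀ {X Y : SSet.{u}} (h : Y ⟶ X) (ρ : Var → (X ⟶ R.K)),
    h ≫ R.interp M ρ = R.interp M fun v => h ≫ ρ v := by
  induction M with
  | var x => exact fun _ _ => rfl
  | app M N ihM ihN => intro X Y h ρ; rw [interp, interp, comp_app, ihM, ihN]
  | lam x M ih =>
    intro X Y h ρ
    rw [interp, interp, ← MonoidalClosed.curry_natural_left_assoc, ih, comp_updateVal,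
      whiskerLeft_fst]
    simp only [whiskerLeft_snd_assoc]

theorem interp_substAll (M : Term) : ∀ {X : SSet.{u}} (σ : Var → Term) (ρ : Var → (X ⟶ R.K)),
    R.interp (M.substAll σ) ρ = R.interp M fun v => R.interp (σ v) ρ := by
  induction M with
  | var x => exact fun _ _ => rfl
  | app M N ihM ihN => intro X σ ρ; rw [Term.substAll, interp, interp, ihM, ihN]
  | lam x M ih =>
    intro X σ ρ
    rw [Term.substAll, interp, interp, ih, interp_update, interp, updateVal_self]
    congr 2
    refine R.interp_congr M (R.updateVal_congr x _ fun v hv => ?_)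
    rw [interp_updateVal_of_notMem, comp_interp]
    exact fun hz => Term.renamed_notMem _ x (Finset.mem_biUnion.2 ⟨v, hv, hz⟩)

theorem interp_lam_app_var {X : SSet.{u}} {M : Term} {y : Var} (hy : y ∉ M.FV)
    (ρ : Var → (X ⟶ R.K)) :
    R.interp (.lam y (.app M (.var y))) ρ = R.interp M ρ ≫ R.F ≫ R.G := by
  rw [interp, interp, interp_updateVal_of_notMem _ hy, ← comp_interp, interp, updateVal_self,
    app, Category.assoc, curry_lift_fst_comp_ev, Category.assoc]

section

open Simplicial

theorem const_interpSimplex {X : SSet.{u}} (M : Term) (ρ : R.Valuation) :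
    (SSet.const (R.interpSimplex M ρ) : X ⟶ R.K) = R.interp M fun v => SSet.const (ρ v) := by
  have h : (SSet.const (R.interpSimplex M ρ) : (Δ[0] : SSet.{u}) ⟶ R.K) =
      R.interp M fun v => SSet.const (ρ v) := by
    simp only [interpSimplex, ← SSet.yonedaEquiv_symm_zero, Equiv.symm_apply_apply]
  let pt : X ⟶ Δ[0] := SSet.const (SSet.stdSimplex.obj₀Equiv.symm 0)
  calc SSet.const (R.interpSimplex M ρ)
    _ = pt ≫ SSet.const (R.interpSimplex M ρ) := (SSet.comp_const ..).symm
    _ = R.interp M fun v => SSet.const (ρ v) := by simp only [h, comp_interp, SSet.comp_const]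

end

variable (ρ : R.Valuation)

theorem interpSimplex_app (L M : Term) :
    R.interpSimplex (.app L M) ρ =
      (R.appLeft (R.interpSimplex L ρ)).app _ (R.interpSimplex M ρ) := by
  apply const_injective
  simp only [← SSet.const_comp, appLeft, comp_app, SSet.comp_const, Category.comp_id]
  simp only [const_interpSimplex, interp]

theorem interpSimplex_subst (M : Term) (x : Var) (P : Term) :
    R.interpSimplex (Term.subst M x P) ρ =
      (R.interpFun x P ρ).app _ (R.interpSimplex M ρ) := by
  apply const_injective
  simp only [const_interpSimplex, Term.subst, interp_substAll, interp_update, interp, interpFun,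
    ← SSet.const_comp, comp_interp, comp_updateVal, SSet.comp_const, Category.comp_id]

theorem interpSimplex_lam_app_var {M : Term} {y : Var} (hy : y ∉ M.FV) :
    R.interpSimplex (.lam y (.app M (.var y))) ρ = (R.F ≫ R.G).app _ (R.interpSimplex M ρ) := by
  apply const_injective
  simp only [← SSet.const_comp, const_interpSimplex, interp_lam_app_var _ hy]

theorem interp_lam_const {X : SSet.{u}} (x : Var) (P : Term) :
    R.interp (.lam x P) (fun v => (SSet.const (ρ v) : X ⟶ R.K)) =
      MonoidalClosed.curry (fst R.K X ≫ R.interpFun x P ρ) ≫ R.G := by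
  simp only [interp, interpFun, comp_interp, comp_updateVal, SSet.comp_const, Category.comp_id]

/-! ### The components of `ε` -/

theorem epsilonAt_comp_evAt (g : R.K ⟶ R.K) (i : Fin 2) :
    R.epsilonAt g ≫ evAt R.K i =
      lift (𝟙 R.K) (MonoidalClosed.curry (fst R.K R.K ≫ g) ≫
        lift (𝟙 _) (SSet.const (SSet.stdSimplex.obj₀Equiv.symm i)) ≫ R.ε.h) ≫
          (ihom.ev R.K).app R.K := by
  simp only [epsilonAt, curry_comp_evAt, comp_lift_assoc, lift_snd, lift_fst,
    comp_curry_fst_comp, SSet.comp_const, Category.comp_id]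

theorem epsilonAt_comp_evAt_zero (g : R.K ⟶ R.K) :
    R.epsilonAt g ≫ evAt R.K 0 =
      R.app (MonoidalClosed.curry (fst R.K R.K ≫ g) ≫ R.G) (𝟙 R.K) := by
  have hε : lift (𝟙 _) (SSet.const (SSet.stdSimplex.obj₀Equiv.symm 0)) ≫ R.ε.h = R.G ≫ R.F :=
    R.ε.h₀
  rw [epsilonAt_comp_evAt, hε, app, Category.assoc]

theorem epsilonAt_comp_evAt_one (g : R.K ⟶ R.K) : R.epsilonAt g ≫ evAt R.K 1 = g := by
  have hε : lift (𝟙 _) (SSet.const (SSet.stdSimplex.obj₀Equiv.symm 1)) ≫ R.ε.h = 𝟙 _ :=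
    R.ε.h₁
  rw [epsilonAt_comp_evAt, hε, Category.comp_id, lift_curry_fst_comp_ev, Category.id_comp]

theorem epsilonAt_interpFun_comp_evAt_zero (x : Var) (P : Term) :
    R.epsilonAt (R.interpFun x P ρ) ≫ evAt R.K 0 = R.appLeft (R.interpSimplex (.lam x P) ρ) := by
  rw [epsilonAt_comp_evAt_zero, appLeft, const_interpSimplex, interp_lam_const]

end ReflexiveKan

/-! ### Inverses of homotopies -/

section Inverses

open Simplicial SSet

section KanComplex

variable {Z : SSet.{u}} [KanComplex Z] {x₀ x₁ x₂ x₃ : Z _⦋0⦌}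

theorem exists_simplex_of_horn_zero {n : ℕ} (x : Fin (n + 2) → Z _⦋n + 1⦌)
    (hx : ∀ i j : Fin (n + 1), i ≤ j → Z.δ j.succ (x i.castSucc) = Z.δ i.succ (x j.succ)) :
    ∃ w : Z _⦋n + 2⦌, ∀ i, Z.δ i.succ w = x i := by
  let f (j : Fin (n + 3)) (hj : j ≠ 0) : (Δ[n + 1] : SSet.{u}) ⟶ Z :=
    yonedaEquiv.symm (x (j.pred hj))
  have hf : horn.IsCompatible f := by
    rw [horn.isCompatible_iff]
    intro j k hj hk hjk
    obtain ⟨j, rfl⟩ := Fin.exists_succ_eq.2 hj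
    obtain ⟨k, rfl⟩ := Fin.exists_succ_eq.2 hk
    rw [Fin.succ_lt_succ_iff] at hjk
    obtain ⟨j, rfl⟩ := Fin.exists_castSucc_eq.2 (Fin.ne_last_of_lt hjk)
    obtain ⟨k, rfl⟩ := Fin.exists_succ_eq.2 (Fin.ne_zero_of_lt hjk)
    have hxjk := hx j k (Fin.castSucc_lt_succ_iff.1 hjk)
    simp only [f, stdSimplex.δ_comp_yonedaEquiv_symm, Fin.pred_succ]
    exact congrArg yonedaEquiv.symm hxjk
  obtain ⟨φ, hφ⟩ := hf.exists_lift_of_kanComplex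
  refine ⟨yonedaEquiv φ, fun i => ?_⟩
  rw [← stdSimplex.yonedaEquiv_δ_comp, hφ _ i.succ_ne_zero]
  simp only [f, Equiv.apply_symm_apply, Fin.pred_succ]

theorem exists_compStruct_of_horn_zero (e₀₁ : Edge x₀ x₁) (e₀₂ : Edge x₀ x₂) :
    ∃ e₁₂ : Edge x₁ x₂, Nonempty (Edge.CompStruct e₀₁ e₁₂ e₀₂) := by
  obtain ⟨w, hw⟩ := exists_simplex_of_horn_zero ![e₀₂.edge, e₀₁.edge] fun i j _ => by
    fin_cases i; fin_cases j
    exact e₀₂.src_eq.trans e₀₁.src_eq.symm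
  have hw₁ : Z.δ 1 w = e₀₂.edge := hw 0
  have hw₂ : Z.δ 2 w = e₀₁.edge := hw 1
  refine ⟨.mk (Z.δ 0 w) ?_ ?_, ⟨.mk w hw₂ rfl hw₁⟩⟩
  · exact (Z.δ_comp_δ_apply (i := 0) (j := 1) (by simp) w).symm.trans
      ((congrArg _ hw₂).trans e₀₁.tgt_eq)
  · exact (Z.δ_comp_δ_apply (i := 0) (j := 0) le_rfl w).symm.trans
      ((congrArg _ hw₁).trans e₀₂.tgt_eq)

theorem nonempty_compStruct_of_horn_zero {e₀₁ : Edge x₀ x₁} {e₀₂ : Edge x₀ x₂}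
    {e₀₃ : Edge x₀ x₃} {e₁₂ : Edge x₁ x₂} {e₁₃ : Edge x₁ x₃} {e₂₃ : Edge x₂ x₃}
    (c₃ : Edge.CompStruct e₀₁ e₁₂ e₀₂) (c₂ : Edge.CompStruct e₀₁ e₁₃ e₀₃)
    (c₁ : Edge.CompStruct e₀₂ e₂₃ e₀₃) : Nonempty (Edge.CompStruct e₁₂ e₂₃ e₁₃) := by
  obtain ⟨w, hw⟩ := exists_simplex_of_horn_zero ![c₁.simplex, c₂.simplex, c₃.simplex]
    fun i j hij => by
      fin_cases i <;> fin_cases j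
      · exact c₁.d₁.trans c₂.d₁.symm
      · exact c₁.d₂.trans c₃.d₁.symm
      · simp at hij
      · exact c₂.d₂.trans c₃.d₂.symm
  have hw₁ : Z.δ 1 w = c₁.simplex := hw 0
  have hw₂ : Z.δ 2 w = c₂.simplex := hw 1
  have hw₃ : Z.δ 3 w = c₃.simplex := hw 2
  refine ⟨.mk (Z.δ 0 w) ?_ ?_ ?_⟩
  · exact (Z.δ_comp_δ_apply (i := 0) (j := 2) (by simp) w).symm.trans
      ((congrArg _ hw₃).trans c₃.d₀)
  · exact (Z.δ_comp_δ_apply (i := 0) (j := 0) le_rfl w).symm.trans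
      ((congrArg _ hw₁).trans c₁.d₀)
  · exact (Z.δ_comp_δ_apply (i := 0) (j := 1) (by simp) w).symm.trans
      ((congrArg _ hw₂).trans c₂.d₀)

theorem nonempty_invStruct (e : Edge x₀ x₁) : Nonempty e.InvStruct := by
  obtain ⟨e', ⟨c⟩⟩ := exists_compStruct_of_horn_zero e (.id x₀)
  -- A 3-simplex with spine `e`, `e'`, `e`; its missing face is the other inverse law.
  obtain ⟨c'⟩ := nonempty_compStruct_of_horn_zero c (.compId e) (.idComp e)
  exact ⟨e', c, c'⟩

end KanComplex

section FunctionComplex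

variable {X Y : SSet.{u}}

/-- The `n`-simplices of `Fun(X, Y)` as maps `X × Δⁿ ⟶ Y`, with `Δⁿ` on the right as in
`SSet.Homotopy`. -/
def funSimplexEquiv {n : ℕ} : (X ⊗ (Δ[n] : SSet.{u}) ⟶ Y) ≃ (Fun X Y) _⦋n⦌ :=
  ((ihom.adjunction X).homEquiv _ _).trans yonedaEquiv

theorem δ_funSimplexEquiv {n : ℕ} (i : Fin (n + 2)) (S : X ⊗ (Δ[n + 1] : SSet.{u}) ⟶ Y) :
    (Fun X Y).δ i (funSimplexEquiv S) = funSimplexEquiv (X ◁ stdSimplex.δ i ≫ S) :=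
  (stdSimplex.yonedaEquiv_δ_comp _ i).symm.trans
    (congrArg yonedaEquiv (MonoidalClosed.curry_natural_left _ S).symm)

theorem σ_funSimplexEquiv {n : ℕ} (i : Fin (n + 1)) (S : X ⊗ (Δ[n] : SSet.{u}) ⟶ Y) :
    (Fun X Y).σ i (funSimplexEquiv S) = funSimplexEquiv (X ◁ stdSimplex.σ i ≫ S) :=
  (stdSimplex.yonedaEquiv_σ_comp _ i).symm.trans
    (congrArg yonedaEquiv (MonoidalClosed.curry_natural_left _ S).symm)

/-- A map `f : X ⟶ Y` as a vertex of `Fun(X, Y)`. -/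
def funVertex (f : X ⟶ Y) : Vertex (Fun X Y) :=
  funSimplexEquiv (fst X (Δ[0] : SSet.{u}) ≫ f)

theorem whiskerLeft_δ_one :
    X ◁ (stdSimplex.δ 1 : (Δ[0] : SSet.{u}) ⟶ Δ[1]) = fst X _ ≫ ι₀ := by
  ext1
  · simp
  · simp only [whiskerLeft_snd, Category.assoc, stdSimplex.δ_one_eq_const]
    rfl

theorem whiskerLeft_δ_zero :
    X ◁ (stdSimplex.δ 0 : (Δ[0] : SSet.{u}) ⟶ Δ[1]) = fst X _ ≫ ι₁ := by
  ext1
  · simp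
  · simp only [whiskerLeft_snd, Category.assoc, stdSimplex.δ_zero_eq_const]
    rfl

instance epi_fst_stdSimplex (n : ℕ) : Epi (fst X (Δ[n] : SSet.{u})) :=
  (SplitEpi.mk (lift (𝟙 X) (const (stdSimplex.const n 0 _))) (lift_fst _ _)).epi

theorem δ_one_funSimplexEquiv_eq_funVertex_iff (k : X ⊗ (Δ[1] : SSet.{u}) ⟶ Y) (f : X ⟶ Y) :
    (Fun X Y).δ 1 (funSimplexEquiv k) = funVertex f ↔ ι₀ ≫ k = f := by
  rw [δ_funSimplexEquiv, funVertex, funSimplexEquiv.apply_eq_iff_eq, whiskerLeft_δ_one,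
    Category.assoc, cancel_epi]

theorem δ_zero_funSimplexEquiv_eq_funVertex_iff (k : X ⊗ (Δ[1] : SSet.{u}) ⟶ Y) (f : X ⟶ Y) :
    (Fun X Y).δ 0 (funSimplexEquiv k) = funVertex f ↔ ι₁ ≫ k = f := by
  rw [δ_funSimplexEquiv, funVertex, funSimplexEquiv.apply_eq_iff_eq, whiskerLeft_δ_zero,
    Category.assoc, cancel_epi]

variable {f g : X ⟶ Y}

/-- A homotopy from `f` to `g` as an edge of `Fun(X, Y)`. -/
def homotopyEdge (H : Homotopy f g) : Edge (funVertex f) (funVertex g) :=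
  .mk (funSimplexEquiv H.h) ((δ_one_funSimplexEquiv_eq_funVertex_iff _ _).2 H.h₀)
    ((δ_zero_funSimplexEquiv_eq_funVertex_iff _ _).2 H.h₁)

theorem homotopyEdge_surjective :
    Function.Surjective (homotopyEdge : Homotopy f g → Edge (funVertex f) (funVertex g)) := by
  intro e
  obtain ⟨k, hk⟩ := funSimplexEquiv.surjective e.edge
  exact ⟨
    { h := k
      h₀ := (δ_one_funSimplexEquiv_eq_funVertex_iff k f).1 (hk ▸ e.src_eq)
      h₁ := (δ_zero_funSimplexEquiv_eq_funVertex_iff k g).1 (hk ▸ e.tgt_eq)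
      rel := by
        ext m ⟨⟨x, hx⟩, _⟩
        exact hx.elim }, Edge.ext hk⟩

theorem exists_of_compStruct_id {H : Homotopy f g} {H' : Homotopy g f}
    (c : Edge.CompStruct (homotopyEdge H) (homotopyEdge H') (.id (funVertex f))) :
    ∃ T : X ⊗ (Δ[2] : SSet.{u}) ⟶ Y, X ◁ stdSimplex.δ 2 ≫ T = H.h ∧
      X ◁ stdSimplex.δ 0 ≫ T = H'.h ∧ X ◁ stdSimplex.δ 1 ≫ T = fst _ _ ≫ f := by
  obtain ⟨T, hT⟩ := funSimplexEquiv.surjective c.simplex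
  refine ⟨T, ?_, ?_, ?_⟩ <;> apply funSimplexEquiv.injective <;> rw [← δ_funSimplexEquiv, hT]
  · exact c.d₂
  · exact c.d₀
  · rw [c.d₁, Edge.id_edge, funVertex, σ_funSimplexEquiv, whiskerLeft_fst_assoc]

theorem exists_areInverse [KanComplex Y] (H : Homotopy f g) :
    ∃ H' : Homotopy g f, AreInverse H H' := by
  obtain ⟨e, c, c'⟩ := nonempty_invStruct (homotopyEdge H)
  obtain ⟨H', rfl⟩ := homotopyEdge_surjective e
  exact ⟨H', exists_of_compStruct_id c, exists_of_compStruct_id c'⟩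

end FunctionComplex

end Inverses

/-! ### Naturality of the contractions -/

namespace Conv

variable (E : ExtensionalKan.{u}) (ρ : E.Valuation)

theorem interp_src : ∀ {n : ℕ} (t : Conv.{u} (n + 1)), t.src.interp E ρ = (t.interp E ρ).src
  | 0, conv _ _ _ => rfl
  | _ + 1, conv _ _ _ => rfl

theorem interp_tgt : ∀ {n : ℕ} (t : Conv.{u} (n + 1)), t.tgt.interp E ρ = (t.interp E ρ).tgt
  | 0, conv _ _ _ => rfl
  | _ + 1, conv _ _ _ => rfl

theorem betaRedex_eq_map (x : Var) (P : Term) : ∀ {n : ℕ} (t : Conv.{u} n),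
    t.betaRedex E ρ x P = (t.interp E ρ).map (E.appLeft (E.interpSimplex (.lam x P) ρ))
  | _, term M => E.interpSimplex_app ρ (.lam x P) M
  | _, conv _ _ _ => rfl

theorem betaContractum_eq_map (x : Var) (P : Term) : ∀ {n : ℕ} (t : Conv.{u} n),
    t.betaContractum E ρ x P = (t.interp E ρ).map (E.interpFun x P ρ)
  | _, term M => E.interpSimplex_subst ρ M x P
  | _, conv _ _ _ => rfl

theorem etaRedex_eq_map {y : Var} : ∀ {n : ℕ} {t : Conv.{u} n}, t.NotFree y →
    t.etaRedex E ρ y = (t.interp E ρ).map (E.F ≫ E.G)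
  | _, term _, hy => E.interpSimplex_lam_app_var ρ hy
  | _, conv _ _ _, _ => rfl

theorem NotFree.src {y : Var} : ∀ {n : ℕ} {t : Conv.{u} (n + 1)}, t.NotFree y → t.src.NotFree y
  | 0, conv _ _ _, h => h.1
  | _ + 1, conv _ _ _, h => ⟨h.1, h.2.1, fun E ρ a => congrArg Cell.src (h.2.2 E ρ a)⟩

theorem NotFree.tgt {y : Var} : ∀ {n : ℕ} {t : Conv.{u} (n + 1)}, t.NotFree y → t.tgt.NotFree y
  | 0, conv _ _ _, h => h.2.1
  | _ + 1, conv _ _ _, h => ⟨h.1, h.2.1, fun E ρ a => congrArg Cell.tgt (h.2.2 E ρ a)⟩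

variable {n : ℕ} (t : Conv.{u} (n + 1))

theorem commutesVia_beta (x : Var) (P : Term) :
    CommutesVia (t.beta E ρ x P)
      (t.src.betaRedex E ρ x P) (t.src.betaContractum E ρ x P)
      (t.tgt.betaRedex E ρ x P) (t.tgt.betaContractum E ρ x P)
      (t.src.beta E ρ x P) (t.tgt.beta E ρ x P)
      (t.betaRedex E ρ x P) (t.betaContractum E ρ x P) := by
  simp only [beta, betaRedex_eq_map, betaContractum_eq_map, interp_src, interp_tgt]
  exact Cell.commutesVia_map (E.epsilonAt_interpFun_comp_evAt_zero ρ x P)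
    (E.epsilonAt_comp_evAt_one _) _

variable {t} in
theorem commutesVia_eta {y : Var} (hy : t.NotFree y)
    (θ : SSet.Homotopy (E.F ≫ E.G) (𝟙 E.K)) :
    CommutesVia (t.eta E ρ θ)
      (t.src.etaRedex E ρ y) (t.src.interp E ρ)
      (t.tgt.etaRedex E ρ y) (t.tgt.interp E ρ)
      (t.src.eta E ρ θ) (t.tgt.eta E ρ θ)
      (t.etaRedex E ρ y) (t.interp E ρ) := by
  simpa only [eta, etaRedex_eq_map E ρ hy, etaRedex_eq_map E ρ hy.src,
    etaRedex_eq_map E ρ hy.tgt, interp_src, interp_tgt, Cell.map_id] using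
    Cell.commutesVia_map (component_comp_evAt_zero θ) (component_comp_evAt_one θ) (t.interp E ρ)

end Conv

end HigherLambda

end

theorem corollary2p1 {n : ℕ} (r s : Conv.{u} n) (t : Conv.{u} (n + 1)) (ht : t.Between r s)
    (E : ExtensionalKan.{u}) (ρ : E.Valuation) :
    (∀ (x : Var) (P : Term),
      CommutesVia (t.beta E ρ x P)
        (r.betaRedex E ρ x P) (r.betaContractum E ρ x P)
        (s.betaRedex E ρ x P) (s.betaContractum E ρ x P)
        (r.beta E ρ x P) (s.beta E ρ x P)
        (t.betaRedex E ρ x P) (t.betaContractum E ρ x P)) ∧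
    (∃ θ : SSet.Homotopy (E.F ≫ E.G) (𝟙 E.K), AreInverse E.η θ) ∧
    (∀ (y : Var), t.NotFree y →
      ∀ θ : SSet.Homotopy (E.F ≫ E.G) (𝟙 E.K), AreInverse E.η θ →
        CommutesVia (t.eta E ρ θ)
          (r.etaRedex E ρ y) (r.interp E ρ)
          (s.etaRedex E ρ y) (s.interp E ρ)
          (r.eta E ρ θ) (s.eta E ρ θ)
          (t.etaRedex E ρ y) (t.interp E ρ)) := by
  obtain ⟨rfl, rfl⟩ := ht
  have := E.kan
  exact ⟨t.commutesVia_beta E ρ, exists_areInverse E.η,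
    fun _ hy θ _ => Conv.commutesVia_eta E ρ hy θ⟩
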